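/- There is a universal constant $\beta\in(0,1)$ such that for every $K>0$ there is a constant $c>0$ depending only on $K$ (in particular an absolute constant when $K=1$) with the following property. Let $d_1,d_2\ge 10$, $p=d_1d_2$, $n\ge 1$, $1\le r\le\min\{d_1,d_2\}$ and $0\le s<p$ be integers, and let $\sigma>0$ and $\mathsf a^*$ be real numbers with $$\mathsf a^*\ge 32\sqrt{\log p}\qquad\text{and}\qquad K\,\mathsf a^*\ge 32\,\sigma\sqrt{\log p}.$$ (The second condition follows from the first if $\sigma\le K$.) Let $X$ be a random matrix in $\mathbb R^{d_1\times d_2}$ that is isotropic, that is, $\mathbb E[\langle X,V\rangle^2]=\|V\|_F^2$ for all $V\in\mathbb R^{d_1\times d_2}$, where $\langle X,V\rangle=\mathrm{tr}(X^\top V)$ and $\|\cdot\|_F$ is the Frobenius norm. For $B,\Gamma\in\mathbb R^{d_1\times d_2}$ let $\mathbb P_{B,\Gamma}$ be the law of the data $(y_i,X_i)_{i=1}^n$, where $$y_i=\langle X_i,B+\Gamma\rangle+\xi_i,$$ $X_1,\dots,X_n$ are i.i.d. copies of $X$, and $\xi_1,\dots,\xi_n$ are i.i.d. $\mathcal N(0,\sigma^2)$,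 independent of $X_1,\dots,X_n$. Let $$\mathcal A(r,s,\mathsf a^*)=\Big\{(B,\Gamma):\ \mathrm{rank}(B)\le r,\ \Gamma\text{ has at most }s\text{ nonzero entries},\ \max_{j,k}|B_{jk}|\le \mathsf a^*/\sqrt n\Big\}$$ and $$\Psi_n(r,s,\mathsf a^*)=\sigma^2\Big\{\frac{r(d_1+d_2)}{n}+\frac sn\log\Big(\frac{p-s}{s/2}\Big)\Big\}+(\mathsf a^*)^2\,\frac sn ,$$ the term containing the logarithm being read as $0$ when $s=0$. Then $$\inf_{(\hat B,\hat\Gamma)}\ \sup_{(B,\Gamma)\in\mathcal A(r,s,\mathsf a^*)}\ \mathbb P_{B,\Gamma}\Big\{\|\hat B-B\|_F^2+\|\hat\Gamma-\Gamma\|_F^2\ \ge\ c\,\Psi_n(r,s,\mathsf a^*)\Big\}\ \ge\ \beta ,$$ where the infimum is over all estimators $(\hat B,\hat\Gamma)$, i.e. all measurable functions of the data $(y_i,X_i)_{i=1}^n$ with values in $\mathbb R^{d_1\times d_2}\times\mathbb R^{d_1\times d_2}$. -/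

import Mathlib

open MeasureTheory ProbabilityTheory

namespace MatrixDecomp

/-- Real matrices of size `d₁ × d₂`. -/
abbrev Mat (d₁ d₂ : ℕ) : Type := Matrix (Fin d₁) (Fin d₂) ℝ

/-- The product (equivalently, Borel) σ-algebra on matrices. -/
instance instMeasurableSpaceMat (d₁ d₂ : ℕ) : MeasurableSpace (Mat d₁ d₂) :=
  inferInstanceAs (MeasurableSpace (Fin d₁ → Fin d₂ → ℝ))

/-- The trace inner product `tr(Vᵀ W)` of two matrices. -/
noncomputable def traceInner {d₁ d₂ : ℕ} (V W : Mat d₁ d₂) : ℝ :=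
  (V.transpose * W).trace

/-- The squared Frobenius norm: the sum of the squares of the entries. -/
noncomputable def frobSq {d₁ d₂ : ℕ} (V : Mat d₁ d₂) : ℝ :=
  ∑ i, ∑ j, (V i j) ^ 2

/-- The number of nonzero entries of a matrix. -/
noncomputable def nnzEntries {d₁ d₂ : ℕ} (V : Mat d₁ d₂) : ℕ :=
  Set.ncard {ij : Fin d₁ × Fin d₂ | V ij.1 ij.2 ≠ 0}

/-- The design law `P` is isotropic: `E ⟨X, V⟩² = ‖V‖_F²` for every matrix `V`.
For `V ≠ 0` the right-hand side is positive, so the equality forces `⟨X, V⟩²` to be integrable. -/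
def Isotropic {d₁ d₂ : ℕ} (P : Measure (Mat d₁ d₂)) : Prop :=
  ∀ V : Mat d₁ d₂, ∫ X, (traceInner X V) ^ 2 ∂P = frobSq V

/-- The parameter class: pairs `(B, Γ)` with `rank B ≤ r`, at most `s` nonzero entries in `Γ`,
and all entries of `B` bounded in absolute value by `a / √n`. -/
def paramClass (d₁ d₂ n r s : ℕ) (a : ℝ) : Set (Mat d₁ d₂ × Mat d₁ d₂) :=
  {Θ | Θ.1.rank ≤ r ∧ nnzEntries Θ.2 ≤ s ∧ ∀ i j, |Θ.1 i j| ≤ a / √(n : ℝ)}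

/-- The law of one observation `(y, X)` with `y = ⟨X, B + Γ⟩ + ξ`, where `X ∼ P` and
`ξ ∼ N(0, σ²)` are independent. -/
noncomputable def obsLaw {d₁ d₂ : ℕ} (P : Measure (Mat d₁ d₂)) (σ : ℝ)
    (Θ : Mat d₁ d₂ × Mat d₁ d₂) : Measure (ℝ × Mat d₁ d₂) :=
  (P.prod (gaussianReal 0 ⟨σ ^ 2, sq_nonneg σ⟩)).map
    (fun z => (traceInner z.1 (Θ.1 + Θ.2) + z.2, z.1))

/-- The law of the sample `(yᵢ, Xᵢ)`, `i = 1, …, n`, of independent copies of `(y, X)`. -/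
noncomputable def dataLaw {d₁ d₂ : ℕ} (n : ℕ) (P : Measure (Mat d₁ d₂)) (σ : ℝ)
    (Θ : Mat d₁ d₂ × Mat d₁ d₂) : Measure (Fin n → ℝ × Mat d₁ d₂) :=
  Measure.pi (fun _ => obsLaw P σ Θ)

/-- Estimators: measurable functions of the data with values in pairs of matrices. -/
def Estimator (d₁ d₂ n : ℕ) : Type :=
  {f : (Fin n → ℝ × Mat d₁ d₂) → Mat d₁ d₂ × Mat d₁ d₂ // Measurable f}

/-- The squared Frobenius error of the estimate `Θ'` of the pair `Θ`. -/
noncomputable def sqError {d₁ d₂ : ℕ} (Θ' Θ : Mat d₁ d₂ × Mat d₁ d₂) : ℝ :=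
  frobSq (Θ'.1 - Θ.1) + frobSq (Θ'.2 - Θ.2)

/-- The rate `σ² {r (d₁ + d₂) / n + (s / n) log ((p - s) / (s / 2))} + a² s / n`, `p = d₁ d₂`
(all operations on real numbers; for `s = 0` the second and third summands vanish). -/
noncomputable def rate (d₁ d₂ n r s : ℕ) (a σ : ℝ) : ℝ :=
  σ ^ 2 * ((r : ℝ) * ((d₁ : ℝ) + d₂) / n
      + (s : ℝ) / n * Real.log (((d₁ : ℝ) * d₂ - s) / ((s : ℝ) / 2)))
    + a ^ 2 * ((s : ℝ) / n)

/-- The minimax probability, over all estimators and the worst parameter in the class, that the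
squared Frobenius error is at least `t`. -/
noncomputable def minimaxProb {d₁ d₂ : ℕ} (n r s : ℕ) (a σ : ℝ) (P : Measure (Mat d₁ d₂))
    (t : ℝ) : ENNReal :=
  ⨅ est : Estimator d₁ d₂ n, ⨆ Θ ∈ paramClass d₁ d₂ n r s a,
    dataLaw n P σ Θ {data | t ≤ sqError (est.1 data) Θ}

end MatrixDecomp

namespace MatrixDecomp

open scoped ENNReal NNReal

/-! ### Product measures and affinities -/

/-! The logarithmic summand of the rate is dominated by the last one: the logarithm is at most `2 *
log p`, and `32 σ √(log p) ≤ K a` bounds `σ² log p` by `K² a² / 1024` (`rate_le`). It remains to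
treat the larger of `σ² r (d₁ + d₂) / n` and `a² s / n`.

The term `a² s / n` comes from non-identifiability. Only `B + Γ` enters the law of the data, so `(B,
-B)` and `(0, 0)` are indistinguishable; taking `B` constant `a / √n` on a rectangle of about `s`
cells gives rank at most one and squared norm of order `a² s / n` (`minimaxProb_ge_of_cancel`,
`minimaxProb_ge_sparse`).

The term `σ² r (d₁ + d₂) / n` comes from a hypercube with `Γ = 0`: `B` has free entries in `{0, δ}`,
`δ` of order `σ / √n`, on `r` full rows or columns. By isotropy a bit flip moves the regression
function by `δ` in `L²(P)`, too little to test (`dataLaw_test_errors`), so averaging over the cube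
forces a fixed proportion of wrong bits (`assouad`, `minimaxProb_ge_lowRank`). -/

theorem lintegral_pi_fin_prod {α : Type*} [MeasurableSpace α] (μ : Measure α) [SigmaFinite μ] :
    ∀ (n : ℕ) (f : Fin n → α → ℝ≥0∞), (∀ i, Measurable (f i)) →
      ∫⁻ x, ∏ i, f i (x i) ∂(Measure.pi fun _ : Fin n => μ) = ∏ i, ∫⁻ x, f i x ∂μ
  | 0, f, _ => by simp
  | n + 1, f, hf => by
    have h := (measurePreserving_piFinSuccAbove (fun _ : Fin (n + 1) => μ) 0).symm
    rw [← h.lintegral_comp (by fun_prop)]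
    simp only [Fin.prod_univ_succ, MeasurableEquiv.piFinSuccAbove_symm_apply]
    simp only [Fin.insertNthEquiv_apply, Fin.insertNth_zero', Fin.cons_zero, Fin.cons_succ]
    rw [lintegral_prod_mul (f := f 0) (g := fun x : Fin n → α => ∏ i, f i.succ (x i))
      (hf 0).aemeasurable
      (Finset.measurable_prod _ fun i _ => (hf i.succ).comp (measurable_pi_apply i)).aemeasurable,
      lintegral_pi_fin_prod μ n _ fun i => hf i.succ]

theorem pi_withDensity_fin {α : Type*} [MeasurableSpace α] (μ : Measure α) [SigmaFinite μ]
    (n : ℕ) (f : α → ℝ≥0∞) (hf : Measurable f) [SigmaFinite (μ.withDensity f)] :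
    Measure.pi (fun _ : Fin n => μ.withDensity f) =
      (Measure.pi fun _ : Fin n => μ).withDensity (fun x => ∏ i, f (x i)) := by
  refine Measure.pi_eq fun s hs => ?_
  rw [withDensity_apply _ (MeasurableSet.univ_pi hs), ← lintegral_indicator (MeasurableSet.univ_pi hs)]
  have h : ∀ x : Fin n → α, (Set.univ.pi s).indicator (fun x => ∏ i, f (x i)) x
      = ∏ i, (s i).indicator f (x i) := by
    intro x
    by_cases hx : x ∈ Set.univ.pi s
    · rw [Set.indicator_of_mem hx]
      exact Finset.prod_congr rfl fun i _ => (Set.indicator_of_mem (hx i trivial) f).symm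
    · rw [Set.indicator_of_notMem hx]
      simp only [Set.mem_univ_pi, not_forall] at hx
      obtain ⟨i, hi⟩ := hx
      exact (Finset.prod_eq_zero (Finset.mem_univ i) (Set.indicator_of_notMem hi f)).symm
  simp_rw [h]
  rw [lintegral_pi_fin_prod μ n (fun i => (s i).indicator f) fun i => hf.indicator (hs i)]
  exact Finset.prod_congr rfl fun i _ => by
    rw [lintegral_indicator (hs i), withDensity_apply _ (hs i)]

/-- Weighted AM-GM: for `F ≤ H`, `√(F H) ≤ F + H / 4`. The bound is linear in `min F H`, `F` and
`H`, so it integrates directly and no Cauchy-Schwarz step is needed to pass from affinity to testing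
errors. -/
theorem geom_le_min_add {F G H : ℝ≥0∞} (h : G ^ 2 = F * H) :
    G ≤ min F H + (F + H) / 4 := by
  by_cases hF : F = ∞
  · simp [hF, ENNReal.top_div]
  by_cases hH : H = ∞
  · simp [hH, ENNReal.top_div]
  have hG : G ≠ ∞ := by
    rintro rfl
    simp only [ne_eq, OfNat.ofNat_ne_zero, not_false_eq_true, ENNReal.top_pow] at h
    exact ENNReal.mul_ne_top hF hH h.symm
  lift F to ℝ≥0 using hF
  lift G to ℝ≥0 using hG
  lift H to ℝ≥0 using hH
  have h' : G ^ 2 = F * H := by exact_mod_cast h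
  have : G ≤ min F H + (F + H) / 4 := by
    have h2 : (G : ℝ) ^ 2 = F * H := by exact_mod_cast h'
    have hF := F.2
    have hH := H.2
    rw [← NNReal.coe_le_coe]
    push_cast
    refine abs_le_of_sq_le_sq' ?_ (by positivity) |>.2
    rw [h2]
    change 0 ≤ (F : ℝ) at hF
    change 0 ≤ (H : ℝ) at hH
    rcases le_total (F : ℝ) H with hl | hl
    · rw [min_eq_left hl]; nlinarith [sq_nonneg ((F : ℝ) - H / 4), mul_nonneg hF hH]
    · rw [min_eq_right hl]; nlinarith [sq_nonneg ((H : ℝ) - F / 4), mul_nonneg hF hH]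
  have h4 : ((4 : ℝ≥0) : ℝ≥0∞) = 4 := rfl
  rw [← h4, ← ENNReal.coe_add, ← ENNReal.coe_div (by norm_num), ← ENNReal.coe_min,
    ← ENNReal.coe_add]
  exact_mod_cast this

/-- The errors of a test between two measures with densities are bounded below by the
integral of the geometric mean of the densities. -/
theorem lintegral_geom_le_test_errors {α : Type*} [MeasurableSpace α] {μ : Measure α}
    {f g h : α → ℝ≥0∞} (hf : Measurable f) (hh : Measurable h)
    (hg : ∀ x, g x ^ 2 = f x * h x) (hf1 : ∫⁻ x, f x ∂μ = 1) (hh1 : ∫⁻ x, h x ∂μ = 1)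
    {A : Set α} (hA : MeasurableSet A) :
    ∫⁻ x, g x ∂μ ≤ μ.withDensity f A + μ.withDensity h Aᶜ + 1 / 2 := by
  calc ∫⁻ x, g x ∂μ ≤ ∫⁻ x, min (f x) (h x) + (f x + h x) / 4 ∂μ :=
        lintegral_mono fun x => geom_le_min_add (hg x)
    _ = ∫⁻ x, min (f x) (h x) ∂μ + (1 + 1) / 4 := by
        rw [lintegral_add_left (hf.min hh)]
        simp only [div_eq_mul_inv]
        rw [lintegral_mul_const (f := fun x => f x + h x) _ (hf.add hh), lintegral_add_left hf, hf1, hh1]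
    _ = ∫⁻ x in A, min (f x) (h x) ∂μ + ∫⁻ x in Aᶜ, min (f x) (h x) ∂μ + 1 / 2 := by
        rw [lintegral_add_compl _ hA]
        congr 1
        rw [← ENNReal.toReal_eq_toReal_iff' (by finiteness) (by finiteness)]
        norm_num
    _ ≤ _ := by
        rw [withDensity_apply _ hA, withDensity_apply _ hA.compl]
        gcongr
        · exact min_le_left _ _
        · exact min_le_right _ _

/-! ### The observation model -/

variable {d₁ d₂ : ℕ}

theorem measurable_entry (i : Fin d₁) (j : Fin d₂) : Measurable fun V : Mat d₁ d₂ => V i j :=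
  (measurable_pi_apply (X := fun _ : Fin d₂ => ℝ) j).comp
    (measurable_pi_apply (X := fun _ : Fin d₁ => Fin d₂ → ℝ) i)

theorem traceInner_eq_sum (V W : Mat d₁ d₂) : traceInner V W = ∑ j, ∑ i, V i j * W i j := by
  simp [traceInner, Matrix.trace, Matrix.mul_apply, Matrix.transpose_apply]

@[fun_prop]
theorem measurable_traceInner_left (W : Mat d₁ d₂) : Measurable fun V => traceInner V W := by
  simp_rw [traceInner_eq_sum]
  exact Finset.measurable_sum _ fun j _ => Finset.measurable_sum _ fun i _ =>
    (measurable_entry i j).mul_const _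

theorem measurable_gaussianPDF_comp {α : Type*} [MeasurableSpace α] (v : ℝ≥0) {m y : α → ℝ}
    (hm : Measurable m) (hy : Measurable y) :
    Measurable fun z => gaussianPDF (m z) v (y z) :=
  measurable_uncurry_gaussianPDF.comp (hm.prodMk (measurable_const.prodMk hy))

/-- The variance `σ²` of the noise. -/
noncomputable def noiseVar (σ : ℝ) : ℝ≥0 := ⟨σ ^ 2, sq_nonneg σ⟩

theorem coe_noiseVar (σ : ℝ) : (noiseVar σ : ℝ) = σ ^ 2 := rfl

theorem noiseVar_ne_zero {σ : ℝ} (hσ : 0 < σ) : noiseVar σ ≠ 0 := fun h =>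
  (pow_pos hσ 2).ne' (congrArg NNReal.toReal h)

theorem obsLaw_eq_map (P : Measure (Mat d₁ d₂)) (σ : ℝ) (Θ : Mat d₁ d₂ × Mat d₁ d₂) :
    obsLaw P σ Θ = (P.prod (gaussianReal 0 (noiseVar σ))).map
      (fun z => (traceInner z.1 (Θ.1 + Θ.2) + z.2, z.1)) := rfl

/-- Conditionally on the design the response is Gaussian, so Lebesgue measure times `P` dominates
every observation law, whatever `P` is. -/
theorem obsLaw_eq_withDensity (P : Measure (Mat d₁ d₂)) [IsProbabilityMeasure P] {σ : ℝ}
    (hσ : 0 < σ) (Θ : Mat d₁ d₂ × Mat d₁ d₂) :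
    obsLaw P σ Θ = ((volume : Measure ℝ).prod P).withDensity
      (fun z => gaussianPDF (traceInner z.2 (Θ.1 + Θ.2)) (noiseVar σ) z.1) := by
  set v : ℝ≥0 := noiseVar σ
  have hv : v ≠ 0 := noiseVar_ne_zero hσ
  ext S hS
  have hm : Measurable fun z : Mat d₁ d₂ × ℝ => (traceInner z.1 (Θ.1 + Θ.2) + z.2, z.1) := by
    fun_prop
  have hp : Measurable fun z : ℝ × Mat d₁ d₂ =>
      gaussianPDF (traceInner z.2 (Θ.1 + Θ.2)) v z.1 :=
    measurable_gaussianPDF_comp v (by fun_prop) (by fun_prop)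
  rw [obsLaw_eq_map, Measure.map_apply hm hS, Measure.prod_apply (hm hS), withDensity_apply _ hS,
    ← lintegral_indicator hS, lintegral_prod_symm _ (hp.indicator hS).aemeasurable]
  refine lintegral_congr fun X => ?_
  have hSX : MeasurableSet ((fun y : ℝ => (y, X)) ⁻¹' S) := measurable_prodMk_right hS
  have h1 : Prod.mk X ⁻¹' ((fun z : Mat d₁ d₂ × ℝ => (traceInner z.1 (Θ.1 + Θ.2) + z.2, z.1)) ⁻¹' S)
      = (fun ξ : ℝ => traceInner X (Θ.1 + Θ.2) + ξ) ⁻¹' ((fun y : ℝ => (y, X)) ⁻¹' S) := rfl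
  rw [h1, ← Measure.map_apply (by fun_prop) hSX, gaussianReal_map_const_add, zero_add,
    gaussianReal_apply _ hv, ← lintegral_indicator hSX]
  rfl

instance isProbabilityMeasure_obsLaw (P : Measure (Mat d₁ d₂)) [IsProbabilityMeasure P] (σ : ℝ)
    (Θ : Mat d₁ d₂ × Mat d₁ d₂) : IsProbabilityMeasure (obsLaw P σ Θ) := by
  rw [obsLaw_eq_map]
  exact Measure.isProbabilityMeasure_map (by fun_prop)

instance isProbabilityMeasure_dataLaw (n : ℕ) (P : Measure (Mat d₁ d₂)) [IsProbabilityMeasure P]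
    (σ : ℝ) (Θ : Mat d₁ d₂ × Mat d₁ d₂) : IsProbabilityMeasure (dataLaw n P σ Θ) := by
  unfold dataLaw; infer_instance

/-- Completing the square: `(y - m)² + (y - m')² = 2 (y - (m + m') / 2)² + (m - m')² / 2`. -/
theorem gaussianPDF_geom (m m' y : ℝ) {v : ℝ≥0} (hv : v ≠ 0) :
    (ENNReal.ofReal (Real.exp (-((m - m') ^ 2 / (8 * v)))) * gaussianPDF ((m + m') / 2) v y) ^ 2
      = gaussianPDF m v y * gaussianPDF m' v y := by
  have hv' : (v : ℝ) ≠ 0 := by exact_mod_cast hv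
  simp only [gaussianPDF]
  rw [← ENNReal.ofReal_mul (Real.exp_nonneg _), ← ENNReal.ofReal_pow
    (mul_nonneg (Real.exp_nonneg _) (gaussianPDFReal_nonneg _ _ _)),
    ← ENNReal.ofReal_mul (gaussianPDFReal_nonneg _ _ _)]
  congr 1
  simp only [gaussianPDFReal]
  set w := (√(2 * Real.pi * v))⁻¹
  have : ∀ A B C D : ℝ, 2 * A + 2 * B = C + D →
      (Real.exp A * (w * Real.exp B)) ^ 2 = w * Real.exp C * (w * Real.exp D) := by
    intro A B C D h
    have h2 : Real.exp A ^ 2 * Real.exp B ^ 2 = Real.exp C * Real.exp D := by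
      rw [← Real.exp_nat_mul, ← Real.exp_nat_mul, ← Real.exp_add, ← Real.exp_add]
      push_cast
      rw [h]
    linear_combination w ^ 2 * h2
  apply this
  field_simp
  ring

/-- Two parameters whose regression functions have squared distance at most `σ² / n` in `L²(P)`
cannot be tested reliably. -/
theorem dataLaw_test_errors (n : ℕ) (P : Measure (Mat d₁ d₂)) [IsProbabilityMeasure P] {σ : ℝ}
    (hσ : 0 < σ) (Θ Θ' : Mat d₁ d₂ × Mat d₁ d₂) {e : ℝ}
    (hint : Integrable (fun X => (traceInner X (Θ.1 + Θ.2) - traceInner X (Θ'.1 + Θ'.2)) ^ 2) P)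
    (he : ∫ X, (traceInner X (Θ.1 + Θ.2) - traceInner X (Θ'.1 + Θ'.2)) ^ 2 ∂P = e)
    (hne : n * e ≤ σ ^ 2) (he1 : e ≤ σ ^ 2)
    {A : Set (Fin n → ℝ × Mat d₁ d₂)} (hA : MeasurableSet A) :
    3 / 8 ≤ dataLaw n P σ Θ A + dataLaw n P σ Θ' Aᶜ := by
  set v : ℝ≥0 := noiseVar σ
  have hvr : (v : ℝ) = σ ^ 2 := coe_noiseVar σ
  have hσ2 : 0 < σ ^ 2 := pow_pos hσ 2
  have hv : v ≠ 0 := noiseVar_ne_zero hσ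
  set m : Mat d₁ d₂ → ℝ := fun X => traceInner X (Θ.1 + Θ.2) with hm
  set m' : Mat d₁ d₂ → ℝ := fun X => traceInner X (Θ'.1 + Θ'.2) with hm'
  have hmm : Measurable m := by fun_prop
  have hmm' : Measurable m' := by fun_prop
  set lam := (volume : Measure ℝ).prod P with hlam
  set f : ℝ × Mat d₁ d₂ → ℝ≥0∞ := fun z => gaussianPDF (m z.2) v z.1 with hf
  set h : ℝ × Mat d₁ d₂ → ℝ≥0∞ := fun z => gaussianPDF (m' z.2) v z.1 with hh
  set E : Mat d₁ d₂ → ℝ := fun X => (m X - m' X) ^ 2 / (8 * v) with hE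
  set g : ℝ × Mat d₁ d₂ → ℝ≥0∞ := fun z =>
    ENNReal.ofReal (Real.exp (-(E z.2))) * gaussianPDF ((m z.2 + m' z.2) / 2) v z.1 with hg
  have hfm : Measurable f := measurable_gaussianPDF_comp v (by fun_prop) (by fun_prop)
  have hhm : Measurable h := measurable_gaussianPDF_comp v (by fun_prop) (by fun_prop)
  have hEm : Measurable E := by fun_prop
  have hgm : Measurable g :=
    Measurable.mul (by fun_prop) (measurable_gaussianPDF_comp v (by fun_prop) (by fun_prop))
  have hΘ : obsLaw P σ Θ = lam.withDensity f := obsLaw_eq_withDensity P hσ Θ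
  have hΘ' : obsLaw P σ Θ' = lam.withDensity h := obsLaw_eq_withDensity P hσ Θ'
  have if1 : IsProbabilityMeasure (lam.withDensity f) := hΘ ▸ inferInstance
  have ih1 : IsProbabilityMeasure (lam.withDensity h) := hΘ' ▸ inferInstance
  -- Integrating out the response leaves the affinity `∫ exp(-E) ∂P`, bounded below through `exp(-E)
  -- ≥ 1 - E`.
  have hρ : ENNReal.ofReal (1 - e / (8 * σ ^ 2)) ≤ ∫⁻ z, g z ∂lam := by
    have h1 : ∫⁻ z, g z ∂lam = ∫⁻ X, ENNReal.ofReal (Real.exp (-(E X))) ∂P := by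
      rw [hlam, lintegral_prod_symm _ hgm.aemeasurable]
      refine lintegral_congr fun X => ?_
      change ∫⁻ y, ENNReal.ofReal (Real.exp (-(E X))) * gaussianPDF ((m X + m' X) / 2) v y = _
      rw [lintegral_const_mul _ (measurable_gaussianPDF _ _), lintegral_gaussianPDF_eq_one _ hv,
        mul_one]
    have hEint : Integrable E P := hint.div_const _
    have hE0 : ∀ X, 0 ≤ E X := fun X => by positivity
    have hexp : Integrable (fun X => Real.exp (-(E X))) P := by
      refine Integrable.of_bound (by fun_prop) 1 (ae_of_all _ fun X => ?_)
      rw [Real.norm_eq_abs, abs_of_pos (Real.exp_pos _)]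
      exact Real.exp_le_one_iff.2 (neg_nonpos.2 (hE0 X))
    rw [h1, ← ofReal_integral_eq_lintegral_ofReal hexp (ae_of_all _ fun X => (Real.exp_pos _).le)]
    refine ENNReal.ofReal_le_ofReal ?_
    have h2 : ∫ X, (1 - E X) ∂P = 1 - e / (8 * σ ^ 2) := by
      rw [integral_sub (integrable_const _) hEint, hE, integral_div, he, hvr]
      simp
    rw [← h2]
    exact integral_mono ((integrable_const _).sub hEint) hexp fun X => by
      have := Real.add_one_le_exp (-(E X)); simp only; linarith
  have he0 : 0 ≤ e := he ▸ integral_nonneg fun X => sq_nonneg _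
  have hρn : ENNReal.ofReal (7 / 8) ≤
      ∫⁻ x, ∏ i, g (x i) ∂(Measure.pi fun _ : Fin n => lam) := by
    rw [lintegral_pi_fin_prod lam n (fun _ => g) fun _ => hgm, Finset.prod_const, Finset.card_univ,
      Fintype.card_fin]
    refine le_trans ?_ (pow_le_pow_left' hρ n)
    -- This uses `he1`, since `hne` says nothing about `e` when `n = 0`. Bernoulli's inequality then
    -- bounds the `n`-th power below by `1 - 1/8`.
    have hε : e / (8 * σ ^ 2) ≤ 1 := (div_le_one (by positivity)).2 (by linarith)
    rw [← ENNReal.ofReal_pow (by linarith)]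
    refine ENNReal.ofReal_le_ofReal ?_
    have hb := one_add_mul_le_pow (a := -(e / (8 * σ ^ 2))) (by linarith) n
    have hn : n * (e / (8 * σ ^ 2)) ≤ 1 / 8 := by
      rw [mul_div_assoc', div_le_div_iff₀ (by positivity) (by norm_num)]
      linarith
    rw [← sub_eq_add_neg] at hb
    linarith
  have hD : dataLaw n P σ Θ = (Measure.pi fun _ : Fin n => lam).withDensity
      (fun x => ∏ i, f (x i)) := by
    rw [dataLaw, hΘ, pi_withDensity_fin lam n f hfm]
  have hD' : dataLaw n P σ Θ' = (Measure.pi fun _ : Fin n => lam).withDensity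
      (fun x => ∏ i, h (x i)) := by
    rw [dataLaw, hΘ', pi_withDensity_fin lam n h hhm]
  have key := lintegral_geom_le_test_errors (μ := Measure.pi fun _ : Fin n => lam)
    (f := fun x => ∏ i, f (x i)) (g := fun x => ∏ i, g (x i)) (h := fun x => ∏ i, h (x i))
    (by fun_prop) (by fun_prop)
    (fun x => by
      rw [← Finset.prod_pow, ← Finset.prod_mul_distrib]
      exact Finset.prod_congr rfl fun i _ => gaussianPDF_geom _ _ _ hv)
    (by
      rw [← setLIntegral_univ, ← withDensity_apply _ MeasurableSet.univ, ← hD]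
      exact measure_univ)
    (by
      rw [← setLIntegral_univ, ← withDensity_apply _ MeasurableSet.univ, ← hD']
      exact measure_univ) hA
  rw [← hD, ← hD'] at key
  have h78 : ENNReal.ofReal (7 / 8) = 3 / 8 + 1 / 2 := by
    rw [← ENNReal.toReal_eq_toReal_iff' (by finiteness) (by finiteness),
      ENNReal.toReal_ofReal (by norm_num), ENNReal.toReal_add (by finiteness) (by finiteness)]
    norm_num
  have := hρn.trans key
  rw [h78] at this
  exact (ENNReal.add_le_add_iff_right (by finiteness)).1 this

/-! ### The hypercube argument -/

/-- Assouad's argument with a bounded loss: if neighbouring vertices of the cube cannot be tested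
and, outside of `E ω`, at most one sixteenth of the bits in `S` is recovered wrongly, then the
largest of the probabilities of the events `E ω` is at least `1 / 8`. -/
theorem assouad {ι α : Type*} [Fintype ι] [DecidableEq ι] [MeasurableSpace α]
    (Q : (ι → Bool) → Measure α) [∀ ω, IsProbabilityMeasure (Q ω)] (S : Finset ι)
    (hS : S.Nonempty) (A : ι → Set α) (hA : ∀ j, MeasurableSet (A j))
    (htest : ∀ j ∈ S, ∀ ω, ∀ C, MeasurableSet C →
      3 / 8 ≤ Q ω C + Q (Function.update ω j (!ω j)) Cᶜ)
    (E : (ι → Bool) → Set α)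
    (hE : ∀ ω, ∀ x ∉ E ω, ∀ W ⊆ S, (∀ j ∈ W, ¬(x ∈ A j ↔ ω j = true)) → 16 * W.card ≤ S.card)
    (t : ℝ≥0∞) (ht : ∀ ω, Q ω (E ω) ≤ t) : ENNReal.ofReal (1 / 8) ≤ t := by
  classical
  set W : ι → (ι → Bool) → Set α := fun j ω => {x | ¬(x ∈ A j ↔ ω j = true)} with hW
  have hWm : ∀ j ω, MeasurableSet (W j ω) := by
    intro j ω
    cases h : ω j
    · have : W j ω = A j := by ext x; simp [hW, h]
      rw [this]; exact hA j
    · have : W j ω = (A j)ᶜ := by ext x; simp [hW, h]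
      rw [this]; exact (hA j).compl
  let flip : ι → (ι → Bool) → (ι → Bool) := fun j ω => Function.update ω j (!ω j)
  have hflip : ∀ j, Function.Involutive (flip j) := by
    intro j ω
    simp [flip]
  have hWflip : ∀ j ω, W j (flip j ω) = (W j ω)ᶜ := by
    intro j ω
    ext x
    simp only [hW, flip, Set.mem_ofPred_eq, Function.update_self, Set.mem_compl_iff]
    cases ω j <;> simp
  have hlow : ∀ j ∈ S, (Fintype.card (ι → Bool) : ℝ≥0∞) * (3 / 8) ≤ 2 * ∑ ω, Q ω (W j ω) := by
    intro j hj
    -- Flipping bit `j` permutes the vertices, so pairing each vertex with its neighbour counts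
    -- every error probability twice.
    have h1 : ∑ ω, Q (flip j ω) (W j (flip j ω)) = ∑ ω, Q ω (W j ω) :=
      Equiv.sum_comp (hflip j).toPerm fun ω => Q ω (W j ω)
    calc (Fintype.card (ι → Bool) : ℝ≥0∞) * (3 / 8) = ∑ _ω : ι → Bool, (3 / 8 : ℝ≥0∞) := by
          rw [Finset.sum_const, Finset.card_univ, nsmul_eq_mul]
      _ ≤ ∑ ω, (Q ω (W j ω) + Q (flip j ω) (W j (flip j ω))) :=
          Finset.sum_le_sum fun ω _ => by
            rw [hWflip]; exact htest j hj ω _ (hWm j ω)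
      _ = 2 * ∑ ω, Q ω (W j ω) := by rw [Finset.sum_add_distrib, h1, two_mul]
  have hup : ∀ ω, ∑ j ∈ S, Q ω (W j ω) ≤ (S.card : ℝ≥0∞) / 16 + S.card * t := by
    intro ω
    calc ∑ j ∈ S, Q ω (W j ω) = ∫⁻ x, ∑ j ∈ S, (W j ω).indicator 1 x ∂(Q ω) := by
          rw [lintegral_finsetSum _ fun j _ => measurable_one.indicator (hWm j ω)]
          exact Finset.sum_congr rfl fun j _ => (lintegral_indicator_one (hWm j ω)).symm
      _ ≤ ∫⁻ x, ((S.card : ℝ≥0∞) / 16 + S.card * (E ω).indicator 1 x) ∂(Q ω) := by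
          refine lintegral_mono fun x => ?_
          have hcount : ∑ j ∈ S, (W j ω).indicator (1 : α → ℝ≥0∞) x
              = ((S.filter fun j => x ∈ W j ω).card : ℝ≥0∞) := by
            rw [Finset.card_filter, Nat.cast_sum]
            refine Finset.sum_congr rfl fun j _ => ?_
            by_cases hx : x ∈ W j ω <;> simp [hx]
          simp only
          rw [hcount]
          by_cases hx : x ∈ E ω
          · rw [Set.indicator_of_mem hx, Pi.one_apply, mul_one]
            exact le_add_left (by exact_mod_cast Finset.card_filter_le _ _)
          · refine le_add_right ?_
            rw [ENNReal.le_div_iff_mul_le (by simp) (by simp), mul_comm]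
            exact_mod_cast hE ω x hx _ (Finset.filter_subset _ _) fun j hj =>
              (Finset.mem_filter.1 hj).2
      _ ≤ _ := by
          rw [lintegral_add_left measurable_const, lintegral_const, measure_univ, mul_one,
            lintegral_const_mul' _ _ (ENNReal.natCast_ne_top _)]
          gcongr
          exact (lintegral_indicator_one_le _).trans (ht ω)
  have htot : (S.card : ℝ≥0∞) * (Fintype.card (ι → Bool) * (3 / 8))
      ≤ 2 * (Fintype.card (ι → Bool) * ((S.card : ℝ≥0∞) / 16 + S.card * t)) := by
    calc (S.card : ℝ≥0∞) * (Fintype.card (ι → Bool) * (3 / 8))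
        = ∑ _j ∈ S, (Fintype.card (ι → Bool) : ℝ≥0∞) * (3 / 8) := by
          rw [Finset.sum_const, nsmul_eq_mul]
      _ ≤ ∑ j ∈ S, 2 * ∑ ω, Q ω (W j ω) := Finset.sum_le_sum hlow
      _ = 2 * ∑ ω, ∑ j ∈ S, Q ω (W j ω) := by rw [← Finset.mul_sum, Finset.sum_comm]
      _ ≤ 2 * ∑ _ω : ι → Bool, ((S.card : ℝ≥0∞) / 16 + S.card * t) := by
          gcongr with ω
          exact hup ω
      _ = _ := by rw [Finset.sum_const, Finset.card_univ, nsmul_eq_mul]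
  by_cases htop : t = ∞
  · simp [htop]
  have hr := ENNReal.toReal_mono (by finiteness) htot
  rw [ENNReal.toReal_mul, ENNReal.toReal_mul, ENNReal.toReal_mul, ENNReal.toReal_mul,
    ENNReal.toReal_add (by finiteness) (by finiteness), ENNReal.toReal_mul, ENNReal.toReal_div,
    ENNReal.toReal_div] at hr
  simp only [ENNReal.toReal_natCast, ENNReal.toReal_ofNat] at hr
  have hm : (0 : ℝ) < S.card := by exact_mod_cast hS.card_pos
  have hN : (0 : ℝ) < Fintype.card (ι → Bool) := by exact_mod_cast Fintype.card_pos
  rw [ENNReal.ofReal_le_iff_le_toReal htop]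
  have hmN := mul_pos hm hN
  -- After division by the number of vertices and `S.card`, `htot` reads `3/8 ≤ 1/8 + 2t`.
  by_contra! hlt
  nlinarith [mul_lt_mul_of_pos_left hlt hmN]

/-- The matrix with entry `δ` at the positions in `S` whose bit is set and `0` elsewhere. -/
noncomputable def cubeMat (δ : ℝ) (S : Finset (Fin d₁ × Fin d₂)) (ω : Fin d₁ × Fin d₂ → Bool) :
    Mat d₁ d₂ :=
  Matrix.of fun i j => if (i, j) ∈ S ∧ ω (i, j) = true then δ else 0

theorem cubeMat_apply (δ : ℝ) (S : Finset (Fin d₁ × Fin d₂)) (ω : Fin d₁ × Fin d₂ → Bool)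
    (i : Fin d₁) (j : Fin d₂) :
    cubeMat δ S ω i j = if (i, j) ∈ S ∧ ω (i, j) = true then δ else 0 := rfl

theorem abs_cubeMat_le {δ : ℝ} (hδ : 0 ≤ δ) (S : Finset (Fin d₁ × Fin d₂))
    (ω : Fin d₁ × Fin d₂ → Bool) (i : Fin d₁) (j : Fin d₂) : |cubeMat δ S ω i j| ≤ δ := by
  rw [cubeMat_apply]
  split_ifs
  · rw [abs_of_nonneg hδ]
  · simpa using hδ

theorem traceInner_sub_right (X V W : Mat d₁ d₂) :
    traceInner X (V - W) = traceInner X V - traceInner X W := by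
  simp [traceInner, Matrix.mul_sub, Matrix.trace_sub]

theorem traceInner_single (X : Mat d₁ d₂) (i : Fin d₁) (j : Fin d₂) (c : ℝ) :
    traceInner X (Matrix.single i j c) = c * X i j := by
  simp [traceInner, Matrix.trace_mul_single, mul_comm]

theorem frobSq_single (i : Fin d₁) (j : Fin d₂) :
    frobSq (Matrix.single i j (1 : ℝ) : Mat d₁ d₂) = 1 := by
  simp only [frobSq, Matrix.single_apply]
  rw [Finset.sum_eq_single i (by intro b _ hb; simp [hb.symm]) (by simp),
    Finset.sum_eq_single j (by intro b _ hb; simp [hb.symm]) (by simp)]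
  simp

theorem frobSq_eq_sum (V : Mat d₁ d₂) : frobSq V = ∑ p : Fin d₁ × Fin d₂, V p.1 p.2 ^ 2 := by
  rw [frobSq, Fintype.sum_prod_type]

theorem frobSq_nonneg (V : Mat d₁ d₂) : 0 ≤ frobSq V :=
  Finset.sum_nonneg fun _ _ => Finset.sum_nonneg fun _ _ => sq_nonneg _

theorem Isotropic.integral_entry_sq {P : Measure (Mat d₁ d₂)} (hP : Isotropic P) (i : Fin d₁)
    (j : Fin d₂) : ∫ X, X i j ^ 2 ∂P = 1 := by
  have h := hP (Matrix.single i j 1)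
  simpa only [traceInner_single, one_mul, frobSq_single] using h

theorem Isotropic.integrable_entry_sq {P : Measure (Mat d₁ d₂)} (hP : Isotropic P) (i : Fin d₁)
    (j : Fin d₂) : Integrable (fun X : Mat d₁ d₂ => X i j ^ 2) P := by
  by_contra h
  have := hP.integral_entry_sq i j
  -- A non-integrable function has Bochner integral `0` by convention, whereas isotropy gives `1`.
  rw [integral_undef h] at this
  exact zero_ne_one this

/-- Neighbouring cube matrices differ by `±δ` in a single entry, so isotropy makes their separation
in `L²(P)` exactly computable. -/
theorem sq_traceInner_cubeMat_flip (δ : ℝ) (S : Finset (Fin d₁ × Fin d₂))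
    (ω : Fin d₁ × Fin d₂ → Bool) {p : Fin d₁ × Fin d₂} (hp : p ∈ S) (X : Mat d₁ d₂) :
    (traceInner X (cubeMat δ S ω) -
      traceInner X (cubeMat δ S (Function.update ω p (!ω p)))) ^ 2 = δ ^ 2 * X p.1 p.2 ^ 2 := by
  have h : cubeMat δ S ω - cubeMat δ S (Function.update ω p (!ω p))
      = Matrix.single p.1 p.2 (if ω p then δ else -δ) := by
    ext i j
    rw [Matrix.sub_apply, cubeMat_apply, cubeMat_apply, Matrix.single_apply]
    by_cases hij : (i, j) = p
    · subst hij
      cases h : ω (i, j) <;> simp [hp]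
    · have : ¬(p.1 = i ∧ p.2 = j) := fun h => hij (Prod.ext h.1.symm h.2.symm)
      simp [hij, this]
  rw [← traceInner_sub_right, h, traceInner_single]
  split_ifs <;> ring

theorem measurable_estimator_fst_entry {n : ℕ} (est : Estimator d₁ d₂ n) (i : Fin d₁)
    (j : Fin d₂) : Measurable fun x => (est.1 x).1 i j :=
  (measurable_entry i j).comp (measurable_fst.comp est.2)

/-- Each bit is decoded by thresholding the estimated entry at `δ / 2`. A wrong bit costs at least
`δ² / 4` in squared error, so an error below `t ≤ S.card * δ² / 64` leaves at most `S.card / 16`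
wrong bits, as `assouad` requires. -/
theorem minimaxProb_ge_of_cube {n r s : ℕ} {a σ δ t : ℝ} {P : Measure (Mat d₁ d₂)}
    [IsProbabilityMeasure P] (hP : Isotropic P) (hσ : 0 < σ) (hn : 1 ≤ n) (hδ : 0 < δ)
    (hδn : n * δ ^ 2 ≤ σ ^ 2) {S : Finset (Fin d₁ × Fin d₂)} (hS : S.Nonempty)
    (hmem : ∀ ω, (cubeMat δ S ω, 0) ∈ paramClass d₁ d₂ n r s a) (ht : 64 * t ≤ S.card * δ ^ 2) :
    ENNReal.ofReal (1 / 8) ≤ minimaxProb n r s a σ P t := by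
  refine le_iInf fun est => ?_
  refine assouad (fun ω => dataLaw n P σ (cubeMat δ S ω, 0)) S hS
    (fun p => {x | δ / 2 ≤ (est.1 x).1 p.1 p.2})
    (fun p => measurableSet_le measurable_const (measurable_estimator_fst_entry est p.1 p.2))
    ?_ (fun ω => {x | t ≤ sqError (est.1 x) (cubeMat δ S ω, 0)}) ?_ _
    fun ω => le_iSup₂_of_le (cubeMat δ S ω, 0) (hmem ω) le_rfl
  · intro p hp ω C hC
    have h := sq_traceInner_cubeMat_flip δ S ω hp
    refine dataLaw_test_errors n P hσ _ _ (e := δ ^ 2) ?_ ?_ hδn ?_ hC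
    · simp only [add_zero, h]
      exact (hP.integrable_entry_sq p.1 p.2).const_mul _
    · simp only [add_zero, h]
      rw [integral_const_mul, hP.integral_entry_sq, mul_one]
    · have : (1 : ℝ) ≤ n := by exact_mod_cast hn
      nlinarith [sq_nonneg δ]
  · intro ω x hx W hWS hW
    simp only [Set.mem_ofPred_eq, not_le] at hx hW
    have h1 : W.card * (δ ^ 2 / 4) ≤ frobSq ((est.1 x).1 - cubeMat δ S ω) := by
      rw [frobSq_eq_sum, ← nsmul_eq_mul, ← Finset.sum_const]
      refine (Finset.sum_le_sum fun p hp => ?_).trans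
        (Finset.sum_le_univ_sum_of_nonneg (s := W) fun p => sq_nonneg _)
      have hw := hW p hp
      rw [Matrix.sub_apply, cubeMat_apply]
      cases h : ω p
      · simp only [h, Bool.false_eq_true, iff_false, not_not] at hw
        simp only [Prod.mk.eta, Bool.false_eq_true, and_false, if_false]
        nlinarith
      · simp only [h, iff_true, not_le] at hw
        simp only [Prod.mk.eta, hWS hp, and_self, if_true]
        nlinarith
    have h2 : frobSq ((est.1 x).1 - cubeMat δ S ω) ≤ sqError (est.1 x) (cubeMat δ S ω, 0) :=
      le_add_of_nonneg_right (frobSq_nonneg _)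
    have h3 : (16 * W.card : ℝ) ≤ S.card := by
      have hδ2 : 0 < δ ^ 2 := pow_pos hδ 2
      by_contra! hlt
      nlinarith [mul_lt_mul_of_pos_right hlt hδ2]
    exact_mod_cast h3

/-! ### The two-point argument -/

theorem frobSq_le_two_mul (V B : Mat d₁ d₂) : frobSq B ≤ 2 * (frobSq V + frobSq (V - B)) := by
  simp only [frobSq_eq_sum]
  rw [← Finset.sum_add_distrib, Finset.mul_sum]
  refine Finset.sum_le_sum fun p _ => ?_
  rw [Matrix.sub_apply]
  nlinarith [sq_nonneg (2 * V p.1 p.2 - B p.1 p.2)]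

theorem frobSq_neg (V : Mat d₁ d₂) : frobSq (-V) = frobSq V := by
  simp [frobSq]

/-- The pairs `(0, 0)` and `(B, -B)` give the same law of the data. -/
theorem minimaxProb_ge_of_cancel {n r s : ℕ} {a σ t : ℝ} {P : Measure (Mat d₁ d₂)}
    [IsProbabilityMeasure P] {B : Mat d₁ d₂} (h0 : (0, 0) ∈ paramClass d₁ d₂ n r s a)
    (hB : (B, -B) ∈ paramClass d₁ d₂ n r s a) (ht : 2 * t ≤ frobSq B) :
    ENNReal.ofReal (1 / 8) ≤ minimaxProb n r s a σ P t := by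
  refine le_iInf fun est => ?_
  set T := ⨆ Θ ∈ paramClass d₁ d₂ n r s a,
    dataLaw n P σ Θ {data | t ≤ sqError (est.1 data) Θ} with hT
  have hlaw : dataLaw n P σ (B, -B) = dataLaw n P σ (0, 0) := by
    simp only [dataLaw, obsLaw, add_neg_cancel, add_zero]
  have h1 : dataLaw n P σ (0, 0) {data | t ≤ sqError (est.1 data) (0, 0)} ≤ T :=
    le_iSup₂_of_le (0, 0) h0 le_rfl
  have h2 : dataLaw n P σ (0, 0) {data | t ≤ sqError (est.1 data) (B, -B)} ≤ T :=
    hlaw ▸ le_iSup₂_of_le (B, -B) hB le_rfl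
  -- No estimate is within `t` of both parameters: `B` and `-B` each contribute `frobSq B / 2` to
  -- the sum of the two errors, which is therefore at least `2 * t`.
  have hcov : (Set.univ : Set (Fin n → ℝ × Mat d₁ d₂)) ⊆
      {data | t ≤ sqError (est.1 data) (0, 0)} ∪ {data | t ≤ sqError (est.1 data) (B, -B)} := by
    intro x _
    by_contra hx
    simp only [Set.mem_union, Set.mem_ofPred_eq, not_or, not_le, sqError, sub_zero] at hx
    have e1 := frobSq_le_two_mul (est.1 x).1 B
    have e2 := frobSq_le_two_mul (est.1 x).2 (-B)
    rw [frobSq_neg] at e2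
    linarith [hx.1, hx.2]
  have h3 : 1 ≤ T + T := by
    rw [← measure_univ (μ := dataLaw n P σ (0, 0))]
    exact (measure_mono hcov).trans ((measure_union_le _ _).trans (add_le_add h1 h2))
  by_cases htop : T = ∞
  · simp [htop]
  rw [ENNReal.ofReal_le_iff_le_toReal htop]
  have := ENNReal.toReal_mono (by finiteness) h3
  rw [ENNReal.toReal_add htop htop, ENNReal.toReal_one] at this
  linarith

/-! ### Membership in the parameter class -/

/-- Right multiplication by the diagonal projection onto `T` fixes `M`. -/
theorem rank_le_card_of_cols (M : Mat d₁ d₂) (T : Finset (Fin d₂))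
    (h : ∀ i, ∀ j ∉ T, M i j = 0) : M.rank ≤ T.card := by
  have hM : M = M * Matrix.diagonal (fun j => if j ∈ T then (1 : ℝ) else 0) := by
    ext i j
    rw [Matrix.mul_diagonal]
    split_ifs with hj
    · rw [mul_one]
    · rw [mul_zero, h i j hj]
  rw [hM]
  refine (Matrix.rank_mul_le_right _ _).trans ?_
  rw [Matrix.rank_diagonal]
  simp

theorem rank_le_card_of_rows (M : Mat d₁ d₂) (T : Finset (Fin d₁))
    (h : ∀ i ∉ T, ∀ j, M i j = 0) : M.rank ≤ T.card := by
  rw [← Matrix.rank_transpose]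
  exact rank_le_card_of_cols M.transpose T fun j i hi => h i hi j

theorem nnzEntries_zero : nnzEntries (0 : Mat d₁ d₂) = 0 := by
  simp [nnzEntries]

theorem exists_finset_fin_card {d k : ℕ} (h : k ≤ d) : ∃ T : Finset (Fin d), T.card = k := by
  obtain ⟨T, -, hT⟩ := Finset.exists_subset_card_eq (s := (Finset.univ : Finset (Fin d)))
    (n := k) (by simpa using h)
  exact ⟨T, hT⟩

theorem zero_mem_paramClass {n r s : ℕ} {a : ℝ} (ha : 0 ≤ a) :
    ((0, 0) : Mat d₁ d₂ × Mat d₁ d₂) ∈ paramClass d₁ d₂ n r s a := by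
  refine ⟨by simp, by simp [nnzEntries_zero], fun i j => ?_⟩
  simp only [Matrix.zero_apply, abs_zero]
  positivity

/-- Every number `s ≤ d₁ d₂` is, up to a factor `2`, the number of cells of a rectangle. -/
theorem exists_rectangle {s : ℕ} (hs : s ≤ d₁ * d₂) (hd₁ : 1 ≤ d₁) (hd₂ : 1 ≤ d₂) :
    ∃ k l, k ≤ d₁ ∧ l ≤ d₂ ∧ k * l ≤ s ∧ s ≤ 2 * (k * l) := by
  rcases le_total s d₂ with h | h
  · exact ⟨1, s, hd₁, h, by simp, by omega⟩
  -- Take as many full rows as fit; the remainder is shorter than one row, and at least one row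
  -- fits.
  · refine ⟨s / d₂, d₂, Nat.div_le_of_le_mul (by rwa [mul_comm]), le_rfl, Nat.div_mul_le_self _ _,
      ?_⟩
    have h1 := Nat.div_add_mod' s d₂
    have h2 := Nat.mod_lt s hd₂
    have h3 : 1 * d₂ ≤ s / d₂ * d₂ :=
      Nat.mul_le_mul_right _ ((Nat.one_le_div_iff hd₂).2 h)
    omega

theorem minimaxProb_ge_sparse {n r s : ℕ} {a σ t : ℝ} {P : Measure (Mat d₁ d₂)}
    [IsProbabilityMeasure P] (hr : 1 ≤ r) (hs : s ≤ d₁ * d₂) (hd₁ : 1 ≤ d₁) (hd₂ : 1 ≤ d₂)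
    (ha : 0 ≤ a) (ht : 4 * t ≤ a ^ 2 * (s / n)) :
    ENNReal.ofReal (1 / 8) ≤ minimaxProb n r s a σ P t := by
  obtain ⟨k, l, hk, hl, hkl, hskl⟩ := exists_rectangle hs hd₁ hd₂
  obtain ⟨T₁, hT₁⟩ := exists_finset_fin_card hk
  obtain ⟨T₂, hT₂⟩ := exists_finset_fin_card hl
  set δ := a / √(n : ℝ) with hδ
  have hδ0 : 0 ≤ δ := by positivity
  set B : Mat d₁ d₂ := cubeMat δ (T₁ ×ˢ T₂) fun _ => true with hB
  have hBapp : ∀ i j, B i j = if (i, j) ∈ T₁ ×ˢ T₂ then δ else 0 := fun i j => by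
    simp [hB, cubeMat_apply]
  have hfrob : (k * l : ℕ) * δ ^ 2 ≤ frobSq B := by
    rw [frobSq_eq_sum, ← hT₁, ← hT₂, ← Finset.card_product, ← nsmul_eq_mul, ← Finset.sum_const]
    refine (Finset.sum_le_sum fun p hp => ?_).trans
      (Finset.sum_le_univ_sum_of_nonneg (s := T₁ ×ˢ T₂) fun p => sq_nonneg _)
    rw [hBapp, if_pos hp]
  refine minimaxProb_ge_of_cancel (B := B) (zero_mem_paramClass ha) ⟨?_, ?_, fun i j =>
    abs_cubeMat_le hδ0 (T₁ ×ˢ T₂) (fun _ => true) i j⟩ ?_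
  · have : B = Matrix.vecMulVec (fun i => if i ∈ T₁ then δ else 0)
        (fun j => if j ∈ T₂ then (1 : ℝ) else 0) := by
      ext i j
      rw [hBapp, Matrix.vecMulVec_apply]
      by_cases h1 : i ∈ T₁ <;> by_cases h2 : j ∈ T₂ <;> simp [h1, h2]
    exact (this ▸ Matrix.rank_vecMulVec_le _ _).trans hr
  · have hsub : {ij : Fin d₁ × Fin d₂ | (-B) ij.1 ij.2 ≠ 0} ⊆ ((T₁ ×ˢ T₂ : Finset _) : Set _) := by
      intro p hp
      by_contra hmem
      refine hp ?_
      rw [Matrix.neg_apply, hBapp, if_neg (by simpa using hmem), neg_zero]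
    refine (Set.ncard_le_ncard hsub (Finset.finite_toSet _)).trans ?_
    rwa [Set.ncard_coe_finset, Finset.card_product, hT₁, hT₂]
  · have h2 : (s : ℝ) ≤ 2 * (k * l : ℕ) := by exact_mod_cast hskl
    have h3 : δ ^ 2 = a ^ 2 / n := by
      rw [hδ, div_pow, Real.sq_sqrt (Nat.cast_nonneg n)]
    have h4 : a ^ 2 * (s / n : ℝ) = s * δ ^ 2 := by rw [h3]; ring
    rw [h4] at ht
    nlinarith [mul_le_mul_of_nonneg_right h2 (sq_nonneg δ), hfrob]

theorem minimaxProb_ge_lowRank {n r s : ℕ} {a σ κ t : ℝ} {P : Measure (Mat d₁ d₂)}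
    [IsProbabilityMeasure P] (hP : Isotropic P) (hσ : 0 < σ) (hn : 1 ≤ n) (hr : 1 ≤ r)
    (hrd : r ≤ min d₁ d₂) (hκ : 0 < κ) (hκ1 : κ ≤ 1) (hκa : κ * σ ≤ a)
    (ht : 128 * t ≤ κ ^ 2 * (σ ^ 2 * (r * (d₁ + d₂) / n))) :
    ENNReal.ofReal (1 / 8) ≤ minimaxProb n r s a σ P t := by
  have hnpos : (0 : ℝ) < n := by exact_mod_cast hn
  set δ := κ * σ / √(n : ℝ) with hδ
  have hδ0 : 0 < δ := by positivity
  have hδ2 : δ ^ 2 = κ ^ 2 * σ ^ 2 / n := by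
    rw [hδ, div_pow, Real.sq_sqrt hnpos.le, mul_pow]
  have hδa : δ ≤ a / √(n : ℝ) := by rw [hδ]; gcongr
  have hδn : n * δ ^ 2 ≤ σ ^ 2 := by
    rw [hδ2, mul_div_cancel₀ _ hnpos.ne']
    have : κ ^ 2 ≤ 1 := pow_le_one₀ hκ.le hκ1
    nlinarith [sq_nonneg σ]
  have hr1 : r ≤ d₁ := hrd.trans (min_le_left _ _)
  have hr2 : r ≤ d₂ := hrd.trans (min_le_right _ _)
  have main : ∀ S : Finset (Fin d₁ × Fin d₂), r * (d₁ + d₂) ≤ 2 * S.card →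
      (∀ ω, (cubeMat δ S ω).rank ≤ r) →
      ENNReal.ofReal (1 / 8) ≤ minimaxProb n r s a σ P t := by
    intro S hS hrank
    have hcard : 0 < S.card := by
      have : 0 < r * (d₁ + d₂) := Nat.mul_pos hr (by omega)
      omega
    refine minimaxProb_ge_of_cube hP hσ hn hδ0 hδn (Finset.card_pos.1 hcard)
      (fun ω => ⟨hrank ω, by simp [nnzEntries_zero], fun i j =>
        (abs_cubeMat_le hδ0.le _ _ i j).trans hδa⟩) ?_
    have hS' : (r * (d₁ + d₂) : ℝ) ≤ 2 * S.card := by exact_mod_cast hS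
    have h4 : κ ^ 2 * (σ ^ 2 * (r * (d₁ + d₂) / n : ℝ)) = (r * (d₁ + d₂)) * δ ^ 2 := by
      rw [hδ2]; ring
    rw [h4] at ht
    nlinarith [mul_le_mul_of_nonneg_right hS' (sq_nonneg δ)]
  -- The `r` free lines run along the longer side, giving `r * max d₁ d₂ ≥ r (d₁ + d₂) / 2` cells.
  rcases le_total d₂ d₁ with hd | hd
  · obtain ⟨T, hT⟩ := exists_finset_fin_card hr2
    refine main (Finset.univ ×ˢ T) ?_ fun ω => ?_
    · rw [Finset.card_product, Finset.card_univ, Fintype.card_fin, hT]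
      nlinarith
    · rw [← hT]
      exact rank_le_card_of_cols _ T fun i j hj => by simp [cubeMat_apply, hj]
  · obtain ⟨T, hT⟩ := exists_finset_fin_card hr1
    refine main (T ×ˢ Finset.univ) ?_ fun ω => ?_
    · rw [Finset.card_product, Finset.card_univ, Fintype.card_fin, hT]
      nlinarith
    · rw [← hT]
      exact rank_le_card_of_rows _ T fun i hi j => by simp [cubeMat_apply, hi]

/-! ### The rate -/

theorem minimaxProb_anti {n r s : ℕ} {a σ t t' : ℝ} {P : Measure (Mat d₁ d₂)} (h : t ≤ t') :
    minimaxProb n r s a σ P t' ≤ minimaxProb n r s a σ P t :=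
  iInf_mono fun _ => iSup₂_mono fun _ _ => measure_mono fun _ hx => h.trans hx

/-- The ratio is at most `2p ≤ p²`. -/
theorem log_ratio_le {p s : ℝ} (hp : 2 ≤ p) (hs : 1 ≤ s) (hsp : s < p) :
    Real.log ((p - s) / (s / 2)) ≤ 2 * Real.log p := by
  have h1 : 0 < (p - s) / (s / 2) := div_pos (by linarith) (by linarith)
  have h2 : (p - s) / (s / 2) ≤ p ^ 2 := by
    rw [div_le_iff₀ (by linarith)]
    nlinarith [mul_le_mul hp hs (by norm_num) (by linarith)]
  calc Real.log ((p - s) / (s / 2)) ≤ Real.log (p ^ 2) := Real.log_le_log h1 h2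
    _ = 2 * Real.log p := by rw [Real.log_pow]; norm_num

theorem rate_le {n r s : ℕ} {a σ K : ℝ} (hd₁ : 10 ≤ d₁) (hd₂ : 10 ≤ d₂) (hs : s < d₁ * d₂)
    (hσ : 0 < σ) (hK : 32 * σ * √(Real.log ((d₁ : ℝ) * d₂)) ≤ K * a) :
    rate d₁ d₂ n r s a σ ≤ σ ^ 2 * (r * (d₁ + d₂) / n)
      + (1 + K ^ 2 / 512) * (a ^ 2 * (s / n)) := by
  have hp : (2 : ℝ) ≤ (d₁ : ℝ) * d₂ := by
    have : 2 ≤ d₁ * d₂ := by nlinarith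
    exact_mod_cast this
  have hlog : 0 ≤ Real.log ((d₁ : ℝ) * d₂) := Real.log_nonneg (by linarith)
  have hsq : 1024 * σ ^ 2 * Real.log ((d₁ : ℝ) * d₂) ≤ K ^ 2 * a ^ 2 := by
    have h := pow_le_pow_left₀ (by positivity) hK 2
    rw [mul_pow, mul_pow, mul_pow, Real.sq_sqrt hlog] at h
    linarith
  have hterm : σ ^ 2 * ((s : ℝ) / n * Real.log (((d₁ : ℝ) * d₂ - s) / ((s : ℝ) / 2)))
      ≤ K ^ 2 / 512 * (a ^ 2 * (s / n)) := by
    rcases Nat.eq_zero_or_pos s with rfl | hs0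
    · simp
    · have hl := log_ratio_le hp (s := s) (by exact_mod_cast hs0) (by exact_mod_cast hs)
      have hl2 : σ ^ 2 * Real.log (((d₁ : ℝ) * d₂ - s) / ((s : ℝ) / 2)) ≤ K ^ 2 / 512 * a ^ 2 := by
        nlinarith [mul_le_mul_of_nonneg_left hl (sq_nonneg σ)]
      have hsn : 0 ≤ (s : ℝ) / n := by positivity
      nlinarith [mul_le_mul_of_nonneg_right hl2 hsn]
  rw [rate, mul_add]
  linarith

end MatrixDecomp

open MatrixDecomp in
theorem mainTheorem5 :
    ∃ β : ℝ, 0 < β ∧ β < 1 ∧ ∀ K : ℝ, 0 < K → ∃ c : ℝ, 0 < c ∧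
      ∀ (d₁ d₂ n r s : ℕ) (a σ : ℝ) (P : MeasureTheory.Measure (MatrixDecomp.Mat d₁ d₂)),
        10 ≤ d₁ → 10 ≤ d₂ → 1 ≤ n →
        1 ≤ r → r ≤ min d₁ d₂ → s < d₁ * d₂ →
        0 < σ →
        32 * √(Real.log ((d₁ : ℝ) * d₂)) ≤ a →
        32 * σ * √(Real.log ((d₁ : ℝ) * d₂)) ≤ K * a →
        MeasureTheory.IsProbabilityMeasure P →
        MatrixDecomp.Isotropic P →
        ENNReal.ofReal β ≤
          MatrixDecomp.minimaxProb n r s a σ P (c * MatrixDecomp.rate d₁ d₂ n r s a σ) := by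
  refine ⟨1 / 8, by norm_num, by norm_num, fun K hK => ?_⟩
  -- With `δ = κ σ / √n`, `κ ≤ 1` keeps bit flips untestable, while `κ ≤ 32 / K` and `log p ≥ 1`
  -- keep the entries below `a / √n`.
  set κ := min 1 (32 / K) with hκdef
  have hκ : 0 < κ := lt_min one_pos (by positivity)
  refine ⟨min (κ ^ 2 / 256) (1 / (8 * (1 + K ^ 2 / 512))), by positivity, ?_⟩
  set c := min (κ ^ 2 / 256) (1 / (8 * (1 + K ^ 2 / 512))) with hc
  intro d₁ d₂ n r s a σ P hd₁ hd₂ hn hr hrd hs hσ ha hKa hP1 hP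
  have ha0 : 0 ≤ a := le_trans (by positivity) ha
  have hκa : κ * σ ≤ a := by
    have h100 : (3 : ℝ) ≤ (d₁ : ℝ) * d₂ := by
      have : 3 ≤ d₁ * d₂ := by nlinarith
      exact_mod_cast this
    have hlog : 1 ≤ Real.log ((d₁ : ℝ) * d₂) := by
      rw [Real.le_log_iff_exp_le (by linarith)]
      linarith [Real.exp_one_lt_d9]
    have hsqrt : 1 ≤ √(Real.log ((d₁ : ℝ) * d₂)) := Real.one_le_sqrt.2 hlog
    have h1 : 32 * σ ≤ K * a := le_trans (le_mul_of_one_le_right (by positivity) hsqrt) hKa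
    have h2 : κ * σ ≤ 32 / K * σ := by gcongr; exact min_le_right _ _
    refine h2.trans ?_
    rw [div_mul_eq_mul_div, div_le_iff₀ hK]
    linarith
  have hrate := rate_le (n := n) (r := r) hd₁ hd₂ hs hσ hKa
  set R₁ := σ ^ 2 * ((r : ℝ) * (d₁ + d₂) / n) with hR₁
  set R₂ := a ^ 2 * ((s : ℝ) / n) with hR₂
  have hR₁0 : 0 ≤ R₁ := by positivity
  have hR₂0 : 0 ≤ R₂ := by positivity
  have hc1 : c ≤ κ ^ 2 / 256 := min_le_left _ _
  have hc2 : c * (1 + K ^ 2 / 512) ≤ 1 / 8 := by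
    have := min_le_right (κ ^ 2 / 256) (1 / (8 * (1 + K ^ 2 / 512)))
    rw [← hc, le_div_iff₀ (by positivity)] at this
    linarith
  have hc0 : 0 ≤ c := by positivity
  have hle : c * rate d₁ d₂ n r s a σ ≤ κ ^ 2 / 256 * R₁ + 1 / 8 * R₂ :=
    calc c * rate d₁ d₂ n r s a σ ≤ c * (R₁ + (1 + K ^ 2 / 512) * R₂) := by gcongr
      _ = c * R₁ + c * (1 + K ^ 2 / 512) * R₂ := by ring
      _ ≤ _ := by gcongr
  refine le_trans ?_ (minimaxProb_anti hle)
  -- The sum is at most twice its larger term, that is `R₂ / 4` or `κ² R₁ / 128`, the thresholds of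
  -- the two lower bounds.
  rcases le_total (κ ^ 2 / 256 * R₁) (1 / 8 * R₂) with h | h
  · exact minimaxProb_ge_sparse hr hs.le (by omega) (by omega) ha0 (by linarith)
  · exact minimaxProb_ge_lowRank hP hσ hn hr hrd hκ (min_le_left _ _) hκa (by linarith)
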